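/- **Setting.** A dueling bandit with $K$ items is given by preference probabilities $p_{i,j}\in[0,1]$ with $p_{i,j}+p_{j,i}=1$. In each round $t=1,\dots,T$ a (possibly randomized) algorithm chooses, depending on the past pairs and feedback, a pair of items $(i_t,j_t)$ and then observes $r_t\in\{0,1\}$, which given the past and $(i_t,j_t)$ is Bernoulli with mean $p_{i_t,j_t}$. The Borda score of item $i$ is $B(i)=\frac1K\sum_{j} p_{i,j}$, the Borda winner is $i^*=\operatorname{argmax}_i B(i)$, and the Borda regret is $$\mathrm{Regret}(T)=\sum_{t=1}^T\bigl(2B(i^*)-B(i_t)-B(j_t)\bigr).$$ **Hard instances.** For $d\ge 1$ and $\Delta>0$, the class consists of the dueling bandits with $K=2^{d+1}$ items $0,\dots,2^{d+1}-1$ for which there is a parameter $\theta\in\{-\Delta,+\Delta\}^d$ with $$p_{i,j}=p^{\theta}_{i,j}=\begin{cases}\frac12 & \text{if } i,j<2^d \text{ or } i,j\ge 2^d,\\ \frac34+\langle \mathrm{bit}(i),\theta\rangle & \text{if } i<2^d\le j,\\ \frac14-\langle \mathrm{bit}(j),\theta\rangle & \text{if } j<2^d\le i,\end{cases}$$ where,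 for $x=\sum_{k=0}^{d-1}b_k2^k$ with $b_k\in\{0,1\}$, $\mathrm{bit}(x)=(2b_0-1,\dots,2b_{d-1}-1)\in\{-1,+1\}^d$. **Theorem.** There is a universal constant $c>0$ such that for all integers $d\ge1$ and $T>4d^2$ there is $\Delta>0$ (depending only on $d$ and $T$) with the following property: for every algorithm $\mathcal A$ there is an instance $\{p^\theta_{i,j}\}$, $\theta\in\{-\Delta,+\Delta\}^d$, in the class above (in particular all $p^\theta_{i,j}\in[0,1]$) on which $$\mathbb E\bigl[\mathrm{Regret}(T)\bigr]\ \ge\ c\,d^{2/3}\,T^{2/3}.$$ -/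

import Mathlib

noncomputable section

namespace DuelingLower

/-- A stochastic dueling bandit with `K` items, given by its matrix of preference probabilities:
`pref i j` is the probability that item `i` is preferred over item `j`.
The laws force `pref i j ≤ 1` and `pref i i = 1 / 2`. -/
structure DuelingBandit (K : ℕ) where
  pref : Fin K → Fin K → ℝ
  pref_nonneg : ∀ i j, 0 ≤ pref i j
  pref_add_swap : ∀ i j, pref i j + pref j i = 1

/-- What is observed in one round: the compared pair `(i, j)` and the feedback
(`true` when `i` was preferred over `j`). -/
abbrev Round (K : ℕ) : Type := (Fin K × Fin K) × Bool

/-- A (possibly randomized) algorithm: for every `t` and every history of `t` completed rounds,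
the probability distribution of the pair compared next. -/
abbrev Algorithm (K : ℕ) : Type := (t : ℕ) → (Fin t → Round K) → PMF (Fin K × Fin K)

namespace DuelingBandit

variable {K : ℕ} (I : DuelingBandit K)

theorem pref_le_one (i j : Fin K) : I.pref i j ≤ 1 := by
  have h := I.pref_add_swap i j
  have h' := I.pref_nonneg j i
  linarith

/-- The law of the feedback when `(i, j)` is compared: `true` has probability `pref i j` and
`false` has probability `1 - pref i j = pref j i`. -/
def feedback (i j : Fin K) : PMF Bool :=
  PMF.ofFintype (fun r => ENNReal.ofReal (if r then I.pref i j else 1 - I.pref i j)) (by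
    have h := I.pref_nonneg i j
    have h' := I.pref_le_one i j
    rw [Fintype.sum_bool, ← ENNReal.ofReal_add (by simpa using h) (by simpa using h')]
    simp)

/-- The law of the history of the first `t` rounds when the algorithm `A` interacts with `I`:
given the past, the next pair is drawn from `A`, and given the past and this pair the feedback
is drawn from the feedback law of the pair. -/
def historyLaw (A : Algorithm K) : (t : ℕ) → PMF (Fin t → Round K)
  | 0 => PMF.pure (fun s => s.elim0)
  | t + 1 =>
      (historyLaw A t).bind fun h =>
        (A t h).bind fun a =>
          (I.feedback a.1 a.2).bind fun r =>
            PMF.pure (Fin.snoc (α := fun _ => Round K) h (a, r))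

/-- The Borda score `B(i) = (1 / K) ∑ j, p i j`. -/
def borda (i : Fin K) : ℝ := (1 / (K : ℝ)) * ∑ j, I.pref i j

/-- The Borda score `max_i B(i)` of a Borda winner. -/
def bordaMax : ℝ := ⨆ i, I.borda i

/-- The Borda regret `∑ t, (2 B(i*) - B(i_t) - B(j_t))` of a history. -/
def regret {T : ℕ} (h : Fin T → Round K) : ℝ :=
  ∑ t, (2 * I.bordaMax - I.borda (h t).1.1 - I.borda (h t).1.2)

/-- The expected Borda regret of the algorithm `A` on `I` over `T` rounds. The expectation is a
finite sum, since there are finitely many histories of length `T`. -/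
def expectedRegret (A : Algorithm K) (T : ℕ) : ℝ :=
  ∑ h : Fin T → Round K, (I.historyLaw A T h).toReal * I.regret h

end DuelingBandit

/-- The shifted bit representation `(2 b₀ - 1, …, 2 b_{d-1} - 1)` of `x`, where `b_k` is the
`k`-th binary digit of `x`. -/
def bitVec (d x : ℕ) : EuclideanSpace ℝ (Fin d) :=
  WithLp.toLp 2 fun k => if x.testBit k then 1 else -1

/-- The feature vectors `φ i j` of the hard instances. Items `i < 2 ^ d` are the good ones. -/
def hardFeature (d : ℕ) (i j : Fin (2 ^ (d + 1))) : EuclideanSpace ℝ (Fin d) :=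
  if (i : ℕ) < 2 ^ d ∧ 2 ^ d ≤ (j : ℕ) then bitVec d i
  else if 2 ^ d ≤ (i : ℕ) ∧ (j : ℕ) < 2 ^ d then -bitVec d j
  else 0

/-- The constant part of the preference probabilities of the hard instances. -/
def hardBias (d : ℕ) (i j : Fin (2 ^ (d + 1))) : ℝ :=
  if (i : ℕ) < 2 ^ d ∧ 2 ^ d ≤ (j : ℕ) then 3 / 4
  else if 2 ^ d ≤ (i : ℕ) ∧ (j : ℕ) < 2 ^ d then 1 / 4
  else 1 / 2

/-- The class of hard instances: the linear dueling bandits with `2 ^ (d + 1)` items whose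
preference probabilities are `hardBias d i j + ⟪hardFeature d i j, θ⟫` for some
`θ ∈ {-Δ, Δ}^d`. Being dueling bandits, they have preference probabilities in `[0, 1]`. -/
def hardClass (d : ℕ) (Δ : ℝ) : Set (DuelingBandit (2 ^ (d + 1))) :=
  {I | ∃ θ : EuclideanSpace ℝ (Fin d), (∀ k, θ k = -Δ ∨ θ k = Δ) ∧
    ∀ i j, I.pref i j = hardBias d i j + inner ℝ (hardFeature d i j) θ}

end DuelingLower

end

/-! Information is expensive: the feedback depends on `θ` only for a mixed pair of a good and a bad
item. A bad item has Borda score 3/8 whatever `θ` is, a good one about 5/8, so each mixed comparison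
costs constant regret, while every bit of the first item that disagrees with the sign of `θ` costs
order `Δ`.

Reversing one sign costs at most `16 * Δ ^ 2` of Hellinger affinity per mixed comparison
(`one_sub_le_affinity_flip`). Affinity loss accumulates along the interaction
(`one_sub_le_sum_sqrt`), so with few mixed rounds the two laws overlap, and a two-point argument
forces order `T` mismatches in that coordinate (`le_sum_prob_add_sum_prob`).

Let `N` be the expected number of mixed rounds, averaged over all signs. The average regret is at
least `N / 8 + d * T * (Δ / 4) * (3 / 16 - 4 * Δ ^ 2 * N)`. If `d * T * Δ ^ 3 ≤ 1 / 8` the terms in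
`N` are harmless, leaving `3 / 64 * (d * T * Δ)`; then `Δ` of order `(d * T) ^ (-1 / 3)` gives the
rate. -/

noncomputable section

namespace DuelingLower

/-! ### Laws of histories. -/

/-- A sum over the histories of length `t + 1`, split according to the last round. -/
theorem sum_snoc {K t : ℕ} (f : (Fin (t + 1) → Round K) → ℝ) :
    ∑ x, f x = ∑ h : Fin t → Round K, ∑ a : Fin K × Fin K, ∑ r : Bool,
      f (Fin.snoc (α := fun _ => Round K) h (a, r)) := by
  rw [← (Fin.snocEquiv (fun _ : Fin (t + 1) => Round K)).sum_comp, Fintype.sum_prod_type_right]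
  refine Finset.sum_congr rfl fun h _ => ?_
  rw [Fintype.sum_prod_type]
  rfl

theorem sum_toReal_pmf {α : Type*} [Fintype α] (p : PMF α) : ∑ a, (p a).toReal = 1 := by
  rw [← ENNReal.toReal_sum fun a _ => p.apply_ne_top a, ← tsum_fintype (L := .unconditional _),
    p.tsum_coe, ENNReal.toReal_one]

namespace DuelingBandit

variable {K : ℕ}

theorem historyLaw_snoc (I : DuelingBandit K) (A : Algorithm K) {t : ℕ}
    (h : Fin t → Round K) (a : Fin K × Fin K) (r : Bool) :
    I.historyLaw A (t + 1) (Fin.snoc (α := fun _ => Round K) h (a, r)) =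
      I.historyLaw A t h * (A t h a * I.feedback a.1 a.2 r) := by
  rw [historyLaw, PMF.bind_apply, tsum_eq_single h]
  · congr 1
    rw [PMF.bind_apply, tsum_eq_single a]
    · congr 1
      rw [PMF.bind_apply, tsum_eq_single r]
      · simp
      · intro r' hr
        rw [PMF.pure_apply, if_neg, mul_zero]
        intro e
        exact hr (congrArg Prod.snd (Fin.snoc_inj.1 e).2).symm
    · intro a' ha
      rw [PMF.bind_apply, ENNReal.tsum_eq_zero.2, mul_zero]
      intro r'
      rw [PMF.pure_apply, if_neg, mul_zero]
      intro e
      exact ha (congrArg Prod.fst (Fin.snoc_inj.1 e).2).symm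
  · intro h' hh
    rw [PMF.bind_apply, ENNReal.tsum_eq_zero.2, mul_zero]
    intro a'
    rw [PMF.bind_apply, ENNReal.tsum_eq_zero.2, mul_zero]
    intro r'
    rw [PMF.pure_apply, if_neg, mul_zero]
    intro e
    exact hh (Fin.snoc_inj.1 e).1.symm

/-- The probability of a history, as a real number. -/
def prob (I : DuelingBandit K) (A : Algorithm K) (t : ℕ) (h : Fin t → Round K) : ℝ :=
  (I.historyLaw A t h).toReal

/-- The probability of a feedback, as a real number. -/
def feedbackProb (I : DuelingBandit K) (a : Fin K × Fin K) (r : Bool) : ℝ :=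
  if r then I.pref a.1 a.2 else 1 - I.pref a.1 a.2

theorem feedbackProb_nonneg (I : DuelingBandit K) (a : Fin K × Fin K) (r : Bool) :
    0 ≤ I.feedbackProb a r := by
  have h := I.pref_nonneg a.1 a.2
  have h' := I.pref_le_one a.1 a.2
  unfold feedbackProb
  split_ifs <;> linarith

theorem sum_feedbackProb (I : DuelingBandit K) (a : Fin K × Fin K) :
    ∑ r, I.feedbackProb a r = 1 := by
  simp [feedbackProb]

theorem prob_nonneg (I : DuelingBandit K) (A : Algorithm K) (t : ℕ) (h : Fin t → Round K) :
    0 ≤ I.prob A t h := ENNReal.toReal_nonneg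

theorem sum_prob (I : DuelingBandit K) (A : Algorithm K) (t : ℕ) : ∑ h, I.prob A t h = 1 :=
  sum_toReal_pmf _

theorem prob_snoc (I : DuelingBandit K) (A : Algorithm K) {t : ℕ}
    (h : Fin t → Round K) (a : Fin K × Fin K) (r : Bool) :
    I.prob A (t + 1) (Fin.snoc (α := fun _ => Round K) h (a, r)) =
      I.prob A t h * ((A t h a).toReal * I.feedbackProb a r) := by
  simp only [prob, historyLaw_snoc, ENNReal.toReal_mul]
  congr 2
  rw [feedback, PMF.ofFintype_apply]
  exact ENNReal.toReal_ofReal (I.feedbackProb_nonneg a r)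

/-- The expectation of a weight accumulated over the rounds satisfies the obvious recursion. -/
theorem sum_prob_mul_sum_succ (I : DuelingBandit K) (A : Algorithm K) (t : ℕ)
    (w : Fin K × Fin K → ℝ) :
    ∑ x, I.prob A (t + 1) x * ∑ s, w (x s).1 =
      ∑ h, I.prob A t h * ∑ s, w (h s).1 +
        ∑ h, I.prob A t h * ∑ a, (A t h a).toReal * w a := by
  rw [sum_snoc, ← Finset.sum_add_distrib]
  refine Finset.sum_congr rfl fun h _ => ?_
  simp only [prob_snoc, Fin.sum_univ_castSucc, Fin.snoc_castSucc, Fin.snoc_last]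
  have key : ∀ a : Fin K × Fin K, ∑ r, I.prob A t h * ((A t h a).toReal * I.feedbackProb a r) *
      (∑ s, w (h s).1 + w a) = I.prob A t h * (∑ s, w (h s).1) * (A t h a).toReal +
        I.prob A t h * ((A t h a).toReal * w a) := by
    intro a
    rw [← Finset.sum_mul, ← Finset.mul_sum, ← Finset.mul_sum, sum_feedbackProb]
    ring
  rw [Finset.sum_congr rfl fun a _ => key a, Finset.sum_add_distrib, ← Finset.mul_sum,
    sum_toReal_pmf, mul_one, ← Finset.mul_sum]

/-! ### Hellinger affinity and the two-point method. -/

/-- A lower bound for the Hellinger affinity of the laws of the history under two instances: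
if one comparison of `a` loses at most `κ * w a` affinity, then the whole interaction loses at
most `κ` times the average expected total weight. -/
theorem one_sub_le_sum_sqrt (I J : DuelingBandit K) (A : Algorithm K) {κ : ℝ} (hκ : 0 ≤ κ)
    {w : Fin K × Fin K → ℝ} (hw : ∀ a, 0 ≤ w a)
    (hIJ : ∀ a, 1 - κ * w a ≤ ∑ r, √(I.feedbackProb a r * J.feedbackProb a r)) (t : ℕ) :
    1 - κ / 2 * (∑ h, I.prob A t h * ∑ s, w (h s).1 + ∑ h, J.prob A t h * ∑ s, w (h s).1) ≤
      ∑ h, √(I.prob A t h * J.prob A t h) := by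
  induction t with
  | zero =>
    have hP : ∀ I : DuelingBandit K, I.prob A 0 default = 1 := fun I => by
      simpa using I.sum_prob A 0
    simp [hP]
  | succ t ih =>
    rw [sum_prob_mul_sum_succ, sum_prob_mul_sum_succ, sum_snoc]
    have key : ∀ h : Fin t → Round K,
        √(I.prob A t h * J.prob A t h) - κ / 2 * (I.prob A t h * ∑ a, (A t h a).toReal * w a +
          J.prob A t h * ∑ a, (A t h a).toReal * w a) ≤
        ∑ a, ∑ r, √(I.prob A (t + 1) (Fin.snoc (α := fun _ => Round K) h (a, r)) *
          J.prob A (t + 1) (Fin.snoc (α := fun _ => Round K) h (a, r))) := by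
      intro h
      set P := I.prob A t h with hP
      set Q := J.prob A t h with hQ
      have hP0 : 0 ≤ P := I.prob_nonneg A t h
      have hQ0 : 0 ≤ Q := J.prob_nonneg A t h
      have hA : ∀ a, 0 ≤ (A t h a).toReal := fun a => ENNReal.toReal_nonneg
      -- Both laws share the algorithm's choice probability, which leaves the square root as a plain
      -- factor.
      have e : ∀ a r, √(I.prob A (t + 1) (Fin.snoc (α := fun _ => Round K) h (a, r)) *
          J.prob A (t + 1) (Fin.snoc (α := fun _ => Round K) h (a, r))) =
          √(P * Q) * ((A t h a).toReal * √(I.feedbackProb a r * J.feedbackProb a r)) := by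
        intro a r
        rw [prob_snoc, prob_snoc, ← hP, ← hQ]
        have : P * ((A t h a).toReal * I.feedbackProb a r) *
            (Q * ((A t h a).toReal * J.feedbackProb a r)) =
            (P * Q) * ((A t h a).toReal ^ 2 * (I.feedbackProb a r * J.feedbackProb a r)) := by
          ring
        rw [this, Real.sqrt_mul (mul_nonneg hP0 hQ0), Real.sqrt_mul (sq_nonneg _),
          Real.sqrt_sq (hA a)]
      simp only [e, ← Finset.mul_sum]
      have h1 : 1 - κ * ∑ a, (A t h a).toReal * w a ≤
          ∑ a, (A t h a).toReal * ∑ r, √(I.feedbackProb a r * J.feedbackProb a r) := by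
        rw [← sum_toReal_pmf (A t h), Finset.mul_sum, ← Finset.sum_sub_distrib]
        refine Finset.sum_le_sum fun a _ => ?_
        have := mul_le_mul_of_nonneg_left (hIJ a) (hA a)
        linarith
      -- AM-GM on the weight of the loss turns it into expectations under the two laws separately.
      have h2 : √(P * Q) ≤ (P + Q) / 2 := by
        rw [Real.sqrt_le_left (by positivity)]
        nlinarith [sq_nonneg (P - Q)]
      have h3 : 0 ≤ κ * ∑ a, (A t h a).toReal * w a :=
        mul_nonneg hκ (Finset.sum_nonneg fun a _ => mul_nonneg (hA a) (hw a))
      have h4 := mul_le_mul_of_nonneg_left h1 (Real.sqrt_nonneg (P * Q))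
      have h5 := mul_le_mul_of_nonneg_right h2 h3
      linarith
    have := Finset.sum_le_sum fun h (_ : h ∈ Finset.univ) => key h
    rw [Finset.sum_sub_distrib, ← Finset.mul_sum, Finset.sum_add_distrib] at this
    linarith

/-- Weighted AM-GM gives `√(m * M) ≤ 2 * m + M / 8` for the minimum `m` and maximum `M`. Being
linear in the affinity, it replaces Cauchy-Schwarz in the two-point method. -/
theorem sqrt_mul_le_min {p q : ℝ} (hp : 0 ≤ p) (hq : 0 ≤ q) :
    √(p * q) ≤ 2 * min p q + (p + q) / 8 := by
  have h0 : 0 ≤ min p q := le_min hp hq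
  rw [Real.sqrt_le_left (by positivity)]
  rcases le_total p q with h | h
  · rw [min_eq_left h]
    nlinarith [sq_nonneg (17 * p - q), mul_nonneg hp hq, mul_nonneg hp hp]
  · rw [min_eq_right h]
    nlinarith [sq_nonneg (17 * q - p), mul_nonneg hp hq, mul_nonneg hq hq]

/-- If two weights add up to at least `C` on every history, their expectations under two
instances cannot both be small unless the two laws are distinguishable. -/
theorem le_sum_prob_add_sum_prob (I J : DuelingBandit K) (A : Algorithm K) {κ : ℝ} (hκ : 0 ≤ κ)
    {w : Fin K × Fin K → ℝ} (hw : ∀ a, 0 ≤ w a)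
    (hIJ : ∀ a, 1 - κ * w a ≤ ∑ r, √(I.feedbackProb a r * J.feedbackProb a r)) (t : ℕ)
    {f g : (Fin t → Round K) → ℝ} (hf : ∀ h, 0 ≤ f h) (hg : ∀ h, 0 ≤ g h) {C : ℝ} (hC : 0 ≤ C)
    (hfg : ∀ h, C ≤ f h + g h) :
    C * (3 / 8 - κ / 4 *
      (∑ h, I.prob A t h * ∑ s, w (h s).1 + ∑ h, J.prob A t h * ∑ s, w (h s).1)) ≤
      ∑ h, I.prob A t h * f h + ∑ h, J.prob A t h * g h := by
  have h1 := I.one_sub_le_sum_sqrt J A hκ hw hIJ t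
  -- The two laws have total mass 2, whence the error `2 / 8`.
  have h2 : ∑ h, √(I.prob A t h * J.prob A t h) ≤
      2 * ∑ h, min (I.prob A t h) (J.prob A t h) + 1 / 4 := by
    have := Finset.sum_le_sum fun h (_ : h ∈ Finset.univ) =>
      sqrt_mul_le_min (I.prob_nonneg A t h) (J.prob_nonneg A t h)
    rw [Finset.sum_add_distrib, ← Finset.mul_sum, ← Finset.sum_div, Finset.sum_add_distrib,
      sum_prob, sum_prob] at this
    linarith
  have h3 : C * ∑ h, min (I.prob A t h) (J.prob A t h) ≤
      ∑ h, I.prob A t h * f h + ∑ h, J.prob A t h * g h := by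
    rw [Finset.mul_sum, ← Finset.sum_add_distrib]
    refine Finset.sum_le_sum fun h _ => ?_
    have hm : 0 ≤ min (I.prob A t h) (J.prob A t h) :=
      le_min (I.prob_nonneg A t h) (J.prob_nonneg A t h)
    have a1 := mul_le_mul_of_nonneg_right (hfg h) hm
    have a2 := mul_le_mul_of_nonneg_right (min_le_left (I.prob A t h) (J.prob A t h)) (hf h)
    have a3 := mul_le_mul_of_nonneg_right (min_le_right (I.prob A t h) (J.prob A t h)) (hg h)
    linarith
  refine le_trans (mul_le_mul_of_nonneg_left ?_ hC) h3
  linarith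

end DuelingBandit

end DuelingLower

end

/-! ### Bits and signs; Borda gaps and affinities of the hard instances. -/

noncomputable section

namespace DuelingLower

/-- The parameter in `{-Δ, Δ}^d` with the given signs. -/
def signVec (d : ℕ) (Δ : ℝ) (s : Fin d → Bool) : EuclideanSpace ℝ (Fin d) :=
  WithLp.toLp 2 fun k => if s k then Δ else -Δ

/-- The indicator that the `k`-th bit of `x` differs from the `k`-th sign. -/
def mismatchAt {d : ℕ} (s : Fin d → Bool) (k : Fin d) (x : ℕ) : ℝ :=
  if x.testBit k = s k then 0 else 1

/-- The number of bits of `x` that differ from the signs `s`. -/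
def mismatch {d : ℕ} (s : Fin d → Bool) (x : ℕ) : ℝ := ∑ k, mismatchAt s k x

theorem mismatchAt_nonneg {d : ℕ} (s : Fin d → Bool) (k : Fin d) (x : ℕ) :
    0 ≤ mismatchAt s k x := by
  unfold mismatchAt
  split_ifs <;> norm_num

theorem mismatchAt_le_one {d : ℕ} (s : Fin d → Bool) (k : Fin d) (x : ℕ) :
    mismatchAt s k x ≤ 1 := by
  unfold mismatchAt
  split_ifs <;> norm_num

theorem mismatch_nonneg {d : ℕ} (s : Fin d → Bool) (x : ℕ) : 0 ≤ mismatch s x :=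
  Finset.sum_nonneg fun k _ => mismatchAt_nonneg s k x

theorem mismatch_le {d : ℕ} (s : Fin d → Bool) (x : ℕ) : mismatch s x ≤ d := by
  simpa [mismatch] using Finset.sum_le_sum fun k (_ : k ∈ Finset.univ) => mismatchAt_le_one s k x

theorem inner_bitVec_signVec (d : ℕ) (Δ : ℝ) (s : Fin d → Bool) (x : ℕ) :
    inner ℝ (bitVec d x) (signVec d Δ s) = Δ * (d - 2 * mismatch s x) := by
  have : (d : ℝ) - 2 * mismatch s x = ∑ k, (1 - 2 * mismatchAt s k x) := by
    simp [mismatch, Finset.mul_sum]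
  rw [this, Finset.mul_sum, PiLp.inner_apply]
  refine Finset.sum_congr rfl fun k _ => ?_
  simp only [bitVec, signVec, mismatchAt]
  cases x.testBit k <;> cases s k <;> simp <;> ring

theorem abs_inner_bitVec_signVec_le {d : ℕ} {Δ : ℝ} (hΔ : 0 ≤ Δ) (s : Fin d → Bool) (x : ℕ) :
    |inner ℝ (bitVec d x) (signVec d Δ s)| ≤ d * Δ := by
  have h1 := mul_nonneg hΔ (mismatch_nonneg s x)
  have h2 := mul_le_mul_of_nonneg_left (mismatch_le s x) hΔ
  rw [inner_bitVec_signVec, abs_le]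
  constructor <;> linarith

/-- The sign vector `s` with its `k`-th sign reversed. -/
def flip {d : ℕ} (k : Fin d) (s : Fin d → Bool) : Fin d → Bool := Function.update s k (!s k)

theorem flip_flip {d : ℕ} (k : Fin d) (s : Fin d → Bool) : flip k (flip k s) = s := by
  simp [flip]

theorem sum_flip {d : ℕ} (k : Fin d) (f : (Fin d → Bool) → ℝ) : ∑ s, f (flip k s) = ∑ s, f s :=
  Equiv.sum_comp (Function.Involutive.toPerm (flip k) (flip_flip k)) f

theorem mismatchAt_add_flip {d : ℕ} (s : Fin d → Bool) (k : Fin d) (x : ℕ) :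
    mismatchAt s k x + mismatchAt (flip k s) k x = 1 := by
  simp only [mismatchAt, flip, Function.update_self]
  cases x.testBit k <;> cases s k <;> simp

theorem inner_signVec_sub_flip_sq {d : ℕ} (Δ : ℝ) (s : Fin d → Bool) (k : Fin d) (x : ℕ) :
    (inner ℝ (bitVec d x) (signVec d Δ s) - inner ℝ (bitVec d x) (signVec d Δ (flip k s))) ^ 2 =
      4 * Δ ^ 2 := by
  have h : mismatch s x - mismatch (flip k s) x =
      mismatchAt s k x - mismatchAt (flip k s) k x := by
    rw [mismatch, mismatch, ← Finset.sum_sub_distrib]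
    refine Finset.sum_eq_single_of_mem k (Finset.mem_univ k) fun l _ hl => ?_
    simp [mismatchAt, flip, Function.update_of_ne hl]
  have h' : (mismatchAt s k x - mismatchAt (flip k s) k x) ^ 2 = 1 := by
    simp only [mismatchAt, flip, Function.update_self]
    cases x.testBit k <;> cases s k <;> simp
  rw [inner_bitVec_signVec, inner_bitVec_signVec]
  calc _ = 4 * Δ ^ 2 * (mismatch s x - mismatch (flip k s) x) ^ 2 := by ring
    _ = _ := by rw [h, h', mul_one]

/-- Toggling bit `k` pairs opposite terms. This is why `θ` averages out of the Borda scores of bad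
items. -/
theorem sum_ite_testBit {d : ℕ} (k : Fin d) :
    ∑ x ∈ Finset.range (2 ^ d), (if x.testBit k then 1 else -1 : ℝ) = 0 := by
  refine Finset.sum_involution (fun x _ => x ^^^ 2 ^ (k : ℕ)) ?_ ?_ ?_ ?_
  · intro x _
    cases h : x.testBit k <;> simp [Nat.testBit_xor, Nat.testBit_two_pow_self, h]
  · intro x _ _ h
    have := congrArg (fun y : ℕ => y.testBit k) h
    simp [Nat.testBit_xor, Nat.testBit_two_pow_self] at this
  · intro x hx
    exact Finset.mem_range.2 (Nat.xor_lt_two_pow (Finset.mem_range.1 hx)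
      (Nat.pow_lt_pow_right one_lt_two k.2))
  · intro x _
    rw [Nat.xor_assoc, Nat.xor_self, Nat.xor_zero]

theorem sum_inner_bitVec (d : ℕ) (θ : EuclideanSpace ℝ (Fin d)) :
    ∑ x ∈ Finset.range (2 ^ d), inner ℝ (bitVec d x) θ = 0 := by
  simp only [PiLp.inner_apply]
  rw [Finset.sum_comm]
  refine Finset.sum_eq_zero fun k _ => ?_
  have := congrArg (θ k * ·) (sum_ite_testBit k)
  simp only [Finset.mul_sum, mul_zero] at this
  rw [← this]
  refine Finset.sum_congr rfl fun x _ => ?_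
  simp [bitVec]

theorem sum_fin_two_pow_succ (d : ℕ) (f g : ℕ → ℝ) :
    ∑ j : Fin (2 ^ (d + 1)), (if (j : ℕ) < 2 ^ d then f j else g j) =
      ∑ x ∈ Finset.range (2 ^ d), f x + ∑ x ∈ Finset.range (2 ^ d), g (2 ^ d + x) := by
  rw [Fin.sum_univ_eq_sum_range (fun j => if j < 2 ^ d then f j else g j), pow_succ, mul_two,
    Finset.sum_range_add]
  congr 1
  · exact Finset.sum_congr rfl fun x hx => if_pos (Finset.mem_range.1 hx)
  · exact Finset.sum_congr rfl fun x _ => if_neg (by omega)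

/-- The indicator that exactly one item of the pair is good, so that the feedback carries
information about the parameter. -/
def mixed (d : ℕ) (a : Fin (2 ^ (d + 1)) × Fin (2 ^ (d + 1))) : ℝ :=
  if ((a.1 : ℕ) < 2 ^ d) ↔ ((a.2 : ℕ) < 2 ^ d) then 0 else 1

theorem mixed_nonneg (d : ℕ) (a : Fin (2 ^ (d + 1)) × Fin (2 ^ (d + 1))) : 0 ≤ mixed d a := by
  unfold mixed
  split_ifs <;> norm_num

/-- The hard instance whose parameter has the signs `s`. -/
def hardInstance (d : ℕ) (Δ : ℝ) (hΔ : 0 ≤ Δ) (h : d * Δ ≤ 1 / 8) (s : Fin d → Bool) :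
    DuelingBandit (2 ^ (d + 1)) where
  pref i j := hardBias d i j + inner ℝ (hardFeature d i j) (signVec d Δ s)
  pref_nonneg i j := by
    have hi := abs_le.1 (abs_inner_bitVec_signVec_le hΔ s i)
    have hj := abs_le.1 (abs_inner_bitVec_signVec_le hΔ s j)
    unfold hardBias hardFeature
    split_ifs <;> try simp only [inner_neg_left, inner_zero_left]
    all_goals linarith
  pref_add_swap i j := by
    unfold hardBias hardFeature
    rcases lt_or_ge (i : ℕ) (2 ^ d) with hi | hi <;> rcases lt_or_ge (j : ℕ) (2 ^ d) with hj | hj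
    all_goals
      simp only [hi, hj, not_le.2, not_lt.2, and_true, and_false, if_true,
        if_false, inner_neg_left, inner_zero_left]
      ring

section

variable {d : ℕ} {Δ : ℝ} (hΔ : 0 ≤ Δ) (h : d * Δ ≤ 1 / 8) (s : Fin d → Bool)

theorem hardInstance_mem_hardClass : hardInstance d Δ hΔ h s ∈ hardClass d Δ := by
  refine ⟨signVec d Δ s, fun k => ?_, fun i j => rfl⟩
  simp only [signVec]
  cases s k <;> simp

theorem borda_hardInstance_of_lt {i : Fin (2 ^ (d + 1))} (hi : (i : ℕ) < 2 ^ d) :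
    (hardInstance d Δ hΔ h s).borda i =
      5 / 8 + inner ℝ (bitVec d i) (signVec d Δ s) / 2 := by
  have e : ∀ j, (hardInstance d Δ hΔ h s).pref i j = if (j : ℕ) < 2 ^ d then 1 / 2
      else 3 / 4 + inner ℝ (bitVec d i) (signVec d Δ s) := by
    intro j
    simp only [hardInstance, hardBias, hardFeature]
    rcases lt_or_ge (j : ℕ) (2 ^ d) with hj | hj <;> simp [hi, hj, not_le.2, not_lt.2]
  simp only [DuelingBandit.borda, e]
  rw [sum_fin_two_pow_succ d (fun _ => 1 / 2)
    (fun _ => 3 / 4 + inner ℝ (bitVec d i) (signVec d Δ s))]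
  simp only [Finset.sum_const, Finset.card_range, nsmul_eq_mul]
  push_cast
  field_simp
  ring

theorem borda_hardInstance_of_ge {i : Fin (2 ^ (d + 1))} (hi : 2 ^ d ≤ (i : ℕ)) :
    (hardInstance d Δ hΔ h s).borda i = 3 / 8 := by
  have e : ∀ j, (hardInstance d Δ hΔ h s).pref i j = if (j : ℕ) < 2 ^ d then
      1 / 4 - inner ℝ (bitVec d j) (signVec d Δ s) else 1 / 2 := by
    intro j
    simp only [hardInstance, hardBias, hardFeature]
    rcases lt_or_ge (j : ℕ) (2 ^ d) with hj | hj <;>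
      simp [hi, hj, not_le.2, not_lt.2, sub_eq_add_neg]
  simp only [DuelingBandit.borda, e]
  rw [sum_fin_two_pow_succ d (fun j => 1 / 4 - inner ℝ (bitVec d j) (signVec d Δ s))
    (fun _ => 1 / 2), Finset.sum_sub_distrib, sum_inner_bitVec]
  simp only [Finset.sum_const, Finset.card_range, nsmul_eq_mul]
  push_cast
  field_simp
  ring

theorem le_bordaMax_hardInstance :
    5 / 8 + d * Δ / 2 ≤ (hardInstance d Δ hΔ h s).bordaMax := by
  -- The witness is the good item whose bits spell the signs `s`.
  have hlt : Nat.ofBits s < 2 ^ (d + 1) :=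
    (Nat.ofBits_lt_two_pow s).trans (Nat.pow_lt_pow_right one_lt_two d.lt_succ_self)
  have hm : mismatch s (Nat.ofBits s) = 0 :=
    Finset.sum_eq_zero fun k _ => by simp [mismatchAt]
  have hb := borda_hardInstance_of_lt hΔ h s (i := ⟨Nat.ofBits s, hlt⟩) (Nat.ofBits_lt_two_pow s)
  rw [inner_bitVec_signVec, hm] at hb
  refine le_trans (le_of_eq ?_)
    (le_ciSup (Set.finite_range _).bddAbove (⟨Nat.ofBits s, hlt⟩ : Fin (2 ^ (d + 1))))
  rw [hb]
  ring

/-- The regret of playing a single item is at least `Δ / 2` per wrong bit. -/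
theorem mismatch_le_gap (i : Fin (2 ^ (d + 1))) :
    Δ / 2 * mismatch s i ≤
      (hardInstance d Δ hΔ h s).bordaMax - (hardInstance d Δ hΔ h s).borda i := by
  have hM := le_bordaMax_hardInstance hΔ h s
  have h1 := mul_nonneg hΔ (mismatch_nonneg s i)
  have h2 := mul_le_mul_of_nonneg_left (mismatch_le s i) hΔ
  rcases lt_or_ge (i : ℕ) (2 ^ d) with hi | hi
  · rw [borda_hardInstance_of_lt hΔ h s hi, inner_bitVec_signVec]
    linarith
  · rw [borda_hardInstance_of_ge hΔ h s hi]
    linarith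

theorem quarter_le_gap {i : Fin (2 ^ (d + 1))} (hi : 2 ^ d ≤ (i : ℕ)) :
    1 / 4 ≤ (hardInstance d Δ hΔ h s).bordaMax - (hardInstance d Δ hΔ h s).borda i := by
  have hM := le_bordaMax_hardInstance hΔ h s
  have : 0 ≤ d * Δ := by positivity
  rw [borda_hardInstance_of_ge hΔ h s hi]
  linarith

/-- If the first item is bad, its single gap must pay for both terms: averaging the bounds `1 / 4`
and `Δ / 2 * mismatch` explains the constants. -/
theorem round_regret_ge (a : Fin (2 ^ (d + 1)) × Fin (2 ^ (d + 1))) :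
    1 / 8 * mixed d a + Δ / 4 * mismatch s a.1 ≤ 2 * (hardInstance d Δ hΔ h s).bordaMax -
      (hardInstance d Δ hΔ h s).borda a.1 - (hardInstance d Δ hΔ h s).borda a.2 := by
  have h1 := mismatch_le_gap hΔ h s a.1
  have h2 := mismatch_le_gap hΔ h s a.2
  have n1 := mul_nonneg hΔ (mismatch_nonneg s a.1)
  have n2 := mul_nonneg hΔ (mismatch_nonneg s a.2)
  unfold mixed
  split_ifs with hm
  · linarith
  · rcases lt_or_ge (a.1 : ℕ) (2 ^ d) with hi | hi
    · have := quarter_le_gap hΔ h s (i := a.2) (by simpa [hi] using hm)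
      linarith
    · have := quarter_le_gap hΔ h s hi
      linarith

theorem regret_ge {T : ℕ} (x : Fin T → Round (2 ^ (d + 1))) :
    1 / 8 * ∑ t, mixed d (x t).1 + Δ / 4 * ∑ k, ∑ t, mismatchAt s k ((x t).1.1 : ℕ) ≤
      (hardInstance d Δ hΔ h s).regret x := by
  rw [Finset.sum_comm, Finset.mul_sum, Finset.mul_sum, ← Finset.sum_add_distrib]
  exact Finset.sum_le_sum fun t _ => round_regret_ge hΔ h s (x t).1

/-- The geometric mean dominates the harmonic mean, which equals `(p + q) / 2 - (p - q) ^ 2 / (2 *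
(p + q))`, and `p + q ≥ 1 / 4`. -/
theorem le_sqrt_mul {p q : ℝ} (hp : 1 / 8 ≤ p) (hq : 1 / 8 ≤ q) :
    (p + q) / 2 - 2 * (p - q) ^ 2 ≤ √(p * q) := by
  have h1 : (p + q) / 2 - 2 * (p - q) ^ 2 ≤ 2 * (p * q) / (p + q) := by
    rw [le_div_iff₀ (by linarith)]
    nlinarith [mul_nonneg (sq_nonneg (p - q)) (by linarith : 0 ≤ p + q - 1 / 4)]
  have h2 : √(p * q) ≤ (p + q) / 2 := by
    rw [Real.sqrt_le_left (by linarith)]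
    nlinarith [sq_nonneg (p - q)]
  refine h1.trans ?_
  rw [div_le_iff₀ (by linarith)]
  have h3 := Real.mul_self_sqrt (show 0 ≤ p * q by positivity)
  have h4 := mul_le_mul_of_nonneg_left h2 (Real.sqrt_nonneg (p * q))
  linarith

/-- For a mixed pair the success probabilities differ by `2 * Δ` and stay in `[1/8, 7/8]`; each of
the two outcomes loses at most `2 * (2 * Δ) ^ 2`. Otherwise both feedbacks are fair coins. -/
theorem one_sub_le_affinity_flip (k : Fin d) (a : Fin (2 ^ (d + 1)) × Fin (2 ^ (d + 1))) :
    1 - 16 * Δ ^ 2 * mixed d a ≤ ∑ r, √((hardInstance d Δ hΔ h s).feedbackProb a r *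
      (hardInstance d Δ hΔ h (flip k s)).feedbackProb a r) := by
  have B : ∀ (s : Fin d → Bool) (x : ℕ), _ := fun s x =>
    abs_le.1 (abs_inner_bitVec_signVec_le hΔ s x)
  have key : ∀ p q : ℝ, 1 / 8 ≤ p → 1 / 8 ≤ q → p ≤ 7 / 8 → q ≤ 7 / 8 →
      (p - q) ^ 2 ≤ 4 * Δ ^ 2 * mixed d a →
      1 - 16 * Δ ^ 2 * mixed d a ≤ √(p * q) + √((1 - p) * (1 - q)) := by
    intro p q hp hq hp' hq' hpq
    have h1 := le_sqrt_mul hp hq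
    have h2 := le_sqrt_mul (p := 1 - p) (q := 1 - q) (by linarith) (by linarith)
    have h3 : (1 - p - (1 - q)) ^ 2 = (p - q) ^ 2 := by ring
    rw [h3] at h2
    linarith
  simp only [DuelingBandit.feedbackProb, Fintype.sum_bool, if_true, Bool.false_eq_true, if_false]
  have b1 := B s a.1
  have b2 := B s a.2
  have b3 := B (flip k s) a.1
  have b4 := B (flip k s) a.2
  have c1 := inner_signVec_sub_flip_sq Δ s k a.1
  have c2 := inner_signVec_sub_flip_sq Δ s k a.2
  apply key <;> simp only [hardInstance, hardBias, hardFeature, mixed] <;>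
  rcases lt_or_ge (a.1 : ℕ) (2 ^ d) with hi | hi <;>
  rcases lt_or_ge (a.2 : ℕ) (2 ^ d) with hj | hj <;>
  simp only [hi, hj, not_le.2, not_lt.2, and_true, and_false, if_true,
        if_false, inner_neg_left, inner_zero_left, iff_true, iff_false, not_true] <;>
  nlinarith

end

end DuelingLower

end

/-! ### Averaging over the signs and tuning `Δ`. -/

noncomputable section

namespace DuelingLower

theorem sum_prob_mul_le_expectedRegret {d T : ℕ} {Δ : ℝ} (hΔ : 0 ≤ Δ) (h : d * Δ ≤ 1 / 8)
    (s : Fin d → Bool) (A : Algorithm (2 ^ (d + 1))) :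
    1 / 8 * ∑ x, (hardInstance d Δ hΔ h s).prob A T x * ∑ t, mixed d (x t).1 +
      Δ / 4 * ∑ k, ∑ x, (hardInstance d Δ hΔ h s).prob A T x *
        ∑ t, mismatchAt s k ((x t).1.1 : ℕ) ≤
      (hardInstance d Δ hΔ h s).expectedRegret A T := by
  rw [Finset.sum_comm, Finset.mul_sum, Finset.mul_sum, ← Finset.sum_add_distrib]
  refine Finset.sum_le_sum fun x _ => ?_
  have := mul_le_mul_of_nonneg_left (regret_ge hΔ h s x)
    ((hardInstance d Δ hΔ h s).prob_nonneg A T x)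
  rw [← Finset.mul_sum]
  refine le_trans (le_of_eq ?_) this
  ring

theorem le_mismatch_add_mismatch_flip {d T : ℕ} {Δ : ℝ} (hΔ : 0 ≤ Δ) (h : d * Δ ≤ 1 / 8)
    (s : Fin d → Bool) (k : Fin d) (A : Algorithm (2 ^ (d + 1))) :
    T * (3 / 8 - 16 * Δ ^ 2 / 4 *
      (∑ x, (hardInstance d Δ hΔ h s).prob A T x * ∑ t, mixed d (x t).1 +
        ∑ x, (hardInstance d Δ hΔ h (flip k s)).prob A T x * ∑ t, mixed d (x t).1)) ≤
      ∑ x, (hardInstance d Δ hΔ h s).prob A T x * ∑ t, mismatchAt s k ((x t).1.1 : ℕ) +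
        ∑ x, (hardInstance d Δ hΔ h (flip k s)).prob A T x *
          ∑ t, mismatchAt (flip k s) k ((x t).1.1 : ℕ) := by
  refine DuelingBandit.le_sum_prob_add_sum_prob _ _ A (by positivity) (mixed_nonneg d)
    (one_sub_le_affinity_flip hΔ h s k) T
    (fun x => Finset.sum_nonneg fun t _ => mismatchAt_nonneg _ _ _)
    (fun x => Finset.sum_nonneg fun t _ => mismatchAt_nonneg _ _ _) T.cast_nonneg fun x => ?_
  rw [← Finset.sum_add_distrib]
  simp [mismatchAt_add_flip]

/-- If `d T Δ ^ 3 ≤ 1 / 8`, then exploring enough to learn the signs costs at least as much as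
not knowing them. -/
theorem exists_le_expectedRegret {d T : ℕ} {Δ : ℝ} (hΔ : 0 ≤ Δ) (h : d * Δ ≤ 1 / 8)
    (h3 : d * T * Δ ^ 3 ≤ 1 / 8) (A : Algorithm (2 ^ (d + 1))) :
    ∃ s, 3 / 64 * (d * T * Δ) ≤ (hardInstance d Δ hΔ h s).expectedRegret A T := by
  set n : (Fin d → Bool) → ℝ := fun s =>
    ∑ x, (hardInstance d Δ hΔ h s).prob A T x * ∑ t, mixed d (x t).1 with hn
  set m : Fin d → (Fin d → Bool) → ℝ := fun k s =>
    ∑ x, (hardInstance d Δ hΔ h s).prob A T x * ∑ t, mismatchAt s k ((x t).1.1 : ℕ) with hm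
  set S : ℝ := ∑ _s : Fin d → Bool, (1 : ℝ) with hS
  have hn0 : 0 ≤ ∑ s, n s := Finset.sum_nonneg fun s _ => Finset.sum_nonneg fun x _ =>
    mul_nonneg (DuelingBandit.prob_nonneg _ _ _ _) (Finset.sum_nonneg fun t _ => mixed_nonneg d _)
  have hk : ∀ k, T * (3 / 16 * S - 4 * Δ ^ 2 * ∑ s, n s) ≤ ∑ s, m k s := by
    intro k
    -- Flipping permutes the sign vectors, so `s` and `flip k s` contribute equal totals.
    have h1 : ∑ s, T * (3 / 8 * 1 - 16 * Δ ^ 2 / 4 * (n s + n (flip k s))) ≤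
        ∑ s, (m k s + m k (flip k s)) := Finset.sum_le_sum fun s _ => by
      rw [mul_one]
      exact le_mismatch_add_mismatch_flip hΔ h s k A
    rw [← Finset.mul_sum, Finset.sum_sub_distrib, ← Finset.mul_sum, ← Finset.mul_sum,
      Finset.sum_add_distrib, Finset.sum_add_distrib, sum_flip k n, sum_flip k (m k), ← hS] at h1
    linarith
  have hsum : d * (T * (3 / 16 * S - 4 * Δ ^ 2 * ∑ s, n s)) ≤ ∑ k, ∑ s, m k s := by
    simpa using Finset.sum_le_sum fun k (_ : k ∈ Finset.univ) => hk k
  have hR : 1 / 8 * ∑ s, n s + Δ / 4 * ∑ k, ∑ s, m k s ≤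
      ∑ s, (hardInstance d Δ hΔ h s).expectedRegret A T := by
    rw [Finset.sum_comm (f := m), Finset.mul_sum, Finset.mul_sum, ← Finset.sum_add_distrib]
    exact Finset.sum_le_sum fun s _ => sum_prob_mul_le_expectedRegret hΔ h s A
  have hfin : ∑ _s : Fin d → Bool, 3 / 64 * (d * T * Δ) ≤
      ∑ s, (hardInstance d Δ hΔ h s).expectedRegret A T := by
    have e : ∑ _s : Fin d → Bool, 3 / 64 * (d * T * Δ) = 3 / 64 * (d * T * Δ) * S := by
      rw [hS, Finset.mul_sum, mul_one]
    have a1 := mul_le_mul_of_nonneg_left hsum (by positivity : 0 ≤ Δ / 4)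
    -- The information term `d * T * Δ ^ 3 * ∑ s, n s` is absorbed by the exploration cost `1 / 8 *
    -- ∑ s, n s`.
    have a2 := mul_le_mul_of_nonneg_right h3 hn0
    rw [e]
    linarith
  obtain ⟨s, -, hs⟩ := Finset.exists_le_of_sum_le Finset.univ_nonempty hfin
  exact ⟨s, hs⟩

end DuelingLower

end

theorem theorem4p1 :
    ∃ c : ℝ, 0 < c ∧
      ∀ d T : ℕ, 0 < d → 4 * d ^ 2 < T →
        ∃ Δ : ℝ, 0 < Δ ∧
          ∀ A : DuelingLower.Algorithm (2 ^ (d + 1)),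
            ∃ I ∈ DuelingLower.hardClass d Δ,
              c * (d : ℝ) ^ (2 / 3 : ℝ) * (T : ℝ) ^ (2 / 3 : ℝ) ≤ I.expectedRegret A T := by
  -- With `Δ = 1 / (8 * x)` and `x ^ 3 = d * T`, the bound `3 / 64 * (d * T * Δ)` is `3 / 512 * x ^
  -- 2`.
  refine ⟨3 / 512, by norm_num, fun d T hd hT => ?_⟩
  have hd0 : (0 : ℝ) < d := by exact_mod_cast hd
  have hT0 : (0 : ℝ) < T := by exact_mod_cast (Nat.zero_le _).trans_lt hT
  have hdT : (d : ℝ) ^ 2 ≤ T := by exact_mod_cast (by omega : d ^ 2 ≤ T)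
  set x : ℝ := (d * T : ℝ) ^ (1 / 3 : ℝ) with hx
  have hx0 : 0 < x := by positivity
  have hx3 : x ^ 3 = d * T := by
    rw [hx, ← Real.rpow_natCast, ← Real.rpow_mul (by positivity)]
    norm_num
  have hx2 : x ^ 2 = (d : ℝ) ^ (2 / 3 : ℝ) * (T : ℝ) ^ (2 / 3 : ℝ) := by
    rw [← Real.mul_rpow hd0.le hT0.le, hx, ← Real.rpow_natCast, ← Real.rpow_mul (by positivity)]
    norm_num
  -- Here `d ^ 2 ≤ T` enters: it makes `d * Δ ≤ 1 / 8`, keeping the probabilities away from 0 and 1.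
  have hdx : d ≤ x := by
    refine le_of_pow_le_pow_left₀ three_ne_zero hx0.le ?_
    rw [hx3, pow_succ']
    exact mul_le_mul_of_nonneg_left hdT hd0.le
  have hΔ : 0 < 1 / (8 * x) := by positivity
  have h : d * (1 / (8 * x)) ≤ 1 / 8 := by
    rw [mul_one_div, div_le_div_iff₀ (by positivity) (by norm_num)]
    linarith
  have h3 : d * T * (1 / (8 * x)) ^ 3 ≤ 1 / 8 := by
    rw [← hx3]
    field_simp
    norm_num
  refine ⟨1 / (8 * x), hΔ, fun A => ?_⟩
  obtain ⟨s, hs⟩ := DuelingLower.exists_le_expectedRegret hΔ.le h h3 A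
  refine ⟨_, DuelingLower.hardInstance_mem_hardClass hΔ.le h s, le_trans (le_of_eq ?_) hs⟩
  rw [mul_assoc, ← hx2, ← hx3]
  field_simp
  norm_num
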